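/- All graphs are finite, simple and undirected. For a connected graph $X$ with distance $d$ and eccentricities $e(u)=\max_v d(u,v)$, the eccentricity matrix $\epsilon(X)$ has entry $d(u,v)$ at $(u,v)$ if $d(u,v)=\min\{e(u),e(v)\}$ and entry $0$ otherwise. The $\epsilon$-spectrum of $X$ is the multiset of eigenvalues of $\epsilon(X)$, and the $\epsilon$-energy of $X$ is the sum of their absolute values. Two graphs of the same order are non-cospectral if their adjacency spectra (as multisets) differ, non-$\epsilon$-cospectral if their $\epsilon$-spectra differ, and $\epsilon$-equienergetic if their $\epsilon$-energies are equal. $L(X)$ is the line graph of $X$, $L^2(X)=L(L(X))$, and $X\cup Y$ is the disjoint union. The subdivision graph $S(X)$ is obtained by replacing each edge $uv$ of $X$ by a path $u\,w\,v$ through a new vertex $w$. The subdivision-vertex join $X\,\dot{\vee}\,Y$ (respectively the subdivision-edge join $X\,\veebar\,Y$) is obtained from the disjoint union of $S(X)$ and $Y$ by joining every original vertex of $X$ (respectively every new vertex of $S(X)$) to every vertex of $Y$. **Theorem.** Let $t\ge 2$, let $G_1$ and $G_2$ be non-cospectral cubic graphs on $2t$ vertices, and let $G$ be any non-empty $r$-regular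 graph with $r\ge 2$. Let $H_1=L^2(G_1)$ and $H_2=L^2(G_2)$. Then: 1. $G\,\dot{\vee}\,H_1$ and $G\,\dot{\vee}\,H_2$ are non-$\epsilon$-cospectral and $\epsilon$-equienergetic. 2. $G\,\veebar\,H_1$ and $G\,\veebar\,H_2$ are non-$\epsilon$-cospectral and $\epsilon$-equienergetic. 3. The three graphs $G\,\dot{\vee}\,(H_1\cup H_2)$, $G\,\dot{\vee}\,(H_1\cup H_1)$ and $G\,\dot{\vee}\,(H_2\cup H_2)$ are pairwise non-$\epsilon$-cospectral and pairwise $\epsilon$-equienergetic. 4. The three graphs $G\,\veebar\,(H_1\cup H_2)$, $G\,\veebar\,(H_1\cup H_1)$ and $G\,\veebar\,(H_2\cup H_2)$ are pairwise non-$\epsilon$-cospectral and pairwise $\epsilon$-equienergetic. -/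

import Mathlib

namespace EccentricityGraphs

open Classical in
/-- The multiset of real eigenvalues of a square real matrix, with algebraic multiplicities.
For a symmetric matrix these are all of its eigenvalues. -/
noncomputable def matrixSpectrum {n : Type*} [Finite n] (M : Matrix n n ℝ) : Multiset ℝ :=
  letI : Fintype n := Fintype.ofFinite n
  M.charpoly.roots

open Classical in
/-- The spectrum of the adjacency matrix of a finite graph, with multiplicities. -/
noncomputable def adjSpectrum {V : Type*} [Finite V] (G : SimpleGraph V) : Multiset ℝ :=
  matrixSpectrum (G.adjMatrix ℝ)

open Classical in
/-- The eccentricity matrix of a finite connected graph: the `(u, v)` entry is the distance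
`d(u, v)` if it equals `min (e(u)) (e(v))`, where `e` is the eccentricity, and is `0` otherwise. -/
noncomputable def eccMatrix {V : Type*} (G : SimpleGraph V) : Matrix V V ℝ :=
  Matrix.of fun u v =>
    if G.edist u v = min (G.eccent u) (G.eccent v) then (G.dist u v : ℝ) else 0

/-- The eccentricity spectrum, with multiplicities. -/
noncomputable def eccSpectrum {V : Type*} [Finite V] (G : SimpleGraph V) : Multiset ℝ :=
  matrixSpectrum (eccMatrix G)

/-- The eccentricity energy: the sum of the absolute values of the eigenvalues of the
eccentricity matrix. -/
noncomputable def eccEnergy {V : Type*} [Finite V] (G : SimpleGraph V) : ℝ :=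
  ((eccSpectrum G).map fun x => |x|).sum

/-- Two graphs of the same order with different adjacency spectra. -/
def NonCospectral {V W : Type*} [Finite V] [Finite W]
    (G : SimpleGraph V) (H : SimpleGraph W) : Prop :=
  Nat.card V = Nat.card W ∧ adjSpectrum G ≠ adjSpectrum H

/-- Two graphs of the same order with different eccentricity spectra. -/
def NonEccCospectral {V W : Type*} [Finite V] [Finite W]
    (G : SimpleGraph V) (H : SimpleGraph W) : Prop :=
  Nat.card V = Nat.card W ∧ eccSpectrum G ≠ eccSpectrum H

/-- Two graphs of the same order with the same eccentricity energy. -/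
def EccEquienergetic {V W : Type*} [Finite V] [Finite W]
    (G : SimpleGraph V) (H : SimpleGraph W) : Prop :=
  Nat.card V = Nat.card W ∧ eccEnergy G = eccEnergy H

/-- The second iterated line graph `L²(G) = L(L(G))`. -/
abbrev lineGraph₂ {V : Type*} (G : SimpleGraph V) :
    SimpleGraph G.lineGraph.edgeSet :=
  G.lineGraph.lineGraph

/-- The subdivision graph `S(G)`: every edge `e` of `G` is replaced by a new vertex `inr e`
adjacent exactly to the two ends of `e`. -/
def subdivision {V : Type*} (G : SimpleGraph V) : SimpleGraph (V ⊕ G.edgeSet) where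
  Adj
    | .inl v, .inr e => v ∈ (e : Sym2 V)
    | .inr e, .inl v => v ∈ (e : Sym2 V)
    | _, _ => False
  symm := ⟨by rintro (a | a) (b | b) h <;> exact h⟩
  loopless := ⟨by rintro (a | a) h <;> exact h⟩

/-- The disjoint union of `G` and `H` together with all edges between the vertex set `S` of `G`
and the whole vertex set of `H`. -/
def joinAlong {V W : Type*} (G : SimpleGraph V) (S : Set V) (H : SimpleGraph W) :
    SimpleGraph (V ⊕ W) where
  Adj
    | .inl a, .inl b => G.Adj a b
    | .inr a, .inr b => H.Adj a b
    | .inl a, .inr _ => a ∈ S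
    | .inr _, .inl b => b ∈ S
  symm := ⟨by
    rintro (a | a) (b | b) h
    · exact G.symm.symm _ _ h
    · exact h
    · exact h
    · exact H.symm.symm _ _ h⟩
  loopless := ⟨by
    rintro (a | a) h
    · exact G.loopless.irrefl _ h
    · exact H.loopless.irrefl _ h⟩

/-- The subdivision-vertex join: every original vertex of `S(G)` is joined to every vertex
of `H`. -/
def subdivVertexJoin {V W : Type*} (G : SimpleGraph V) (H : SimpleGraph W) :
    SimpleGraph ((V ⊕ G.edgeSet) ⊕ W) :=
  joinAlong (subdivision G) (Set.range Sum.inl) H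

/-- The subdivision-edge join: every new (subdividing) vertex of `S(G)` is joined to every vertex
of `H`. -/
def subdivEdgeJoin {V W : Type*} (G : SimpleGraph V) (H : SimpleGraph W) :
    SimpleGraph ((V ⊕ G.edgeSet) ⊕ W) :=
  joinAlong (subdivision G) (Set.range Sum.inr) H

end EccentricityGraphs

open scoped SimpleGraph
open EccentricityGraphs

/-! Attach `H` to a base graph along a set `S` satisfying `IsJoinBase`. Every vertex of `H` then has
eccentricity 2 and every base vertex at least 2. The eccentricity matrix therefore has `H`-block 2(J
- I - A(H)), cross blocks 2 or 0 according to membership in the complement of `S`, and a base block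
that does not depend on `H`, provided `H` is nonempty (`IsJoinBase.eccMatrix_joinAlong`,
`IsJoinBase.eccMatrix_inl_inl_eq`).

If `H` is regular, the all-ones vector is an eigenvector of A(H). A Schur complement shows that the
characteristic polynomial is that of -2A(H) - 2I times a factor depending only on the base, the
degree and the order of `H` (`matrixSpectrum_fromBlocks_vecMulVec`). For two such graphs of equal
degree and order, the joins are thus non-ε-cospectral when the adjacency spectra differ, and
ε-equienergetic when the sums of |x + 1| over the adjacency spectra agree.

For a cubic graph on n vertices, L² has eigenvalues x + 3 (x an eigenvalue of the graph), 0 (n/2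
times) and -2 (3n/2 times). Since x ≥ -3 and the x sum to 0, the sum of |x + 1| is 4n + n/2 + 3n/2 =
6n, whatever the graph. The spectrum of L² still determines that of the graph, and disjoint unions
add spectra. -/

namespace EccentricityGraphs

open Matrix Polynomial

/-! ### Extended distances in graphs -/

section Distance

variable {V W : Type*} {G : SimpleGraph V} {H : SimpleGraph W}

/-- A map sending each edge to an edge or to a single vertex does not increase distances. -/
theorem edist_map_le (f : V → W) (hf : ∀ a b, G.Adj a b → f a = f b ∨ H.Adj (f a) (f b))
    (a b : V) : H.edist (f a) (f b) ≤ G.edist a b := by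
  refine le_iInf fun p => ?_
  induction p with
  | nil => simp
  | @cons u v w h p ih =>
    rw [SimpleGraph.Walk.length_cons, Nat.cast_add, Nat.cast_one, add_comm]
    refine (H.edist_triangle (v := f v)).trans (add_le_add ?_ ih)
    rw [SimpleGraph.edist_le_one_iff_adj_or_eq]
    exact (hf _ _ h).symm

theorem two_le_edist {u v : V} (hne : u ≠ v) (hadj : ¬ G.Adj u v) : 2 ≤ G.edist u v := by
  have h : ¬ G.edist u v ≤ 1 := by
    rw [SimpleGraph.edist_le_one_iff_adj_or_eq]; tauto
  simpa [one_add_one_eq_two] using Order.add_one_le_of_lt (not_le.mp h)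

theorem edist_le_two {u v w : V} (huv : G.Adj u v) (hvw : G.Adj v w) : G.edist u w ≤ 2 := by
  refine (G.edist_triangle (v := v)).trans ?_
  rw [SimpleGraph.edist_eq_one_iff_adj.mpr huv, SimpleGraph.edist_eq_one_iff_adj.mpr hvw,
    one_add_one_eq_two]

theorem dist_eq_two_of_edist {u v : V} (h : G.edist u v = 2) : G.dist u v = 2 := by
  rw [SimpleGraph.dist, h]; rfl

end Distance

/-! ### Eccentricity matrix of a join -/

section JoinAlong

variable {V W W' : Type*} {G : SimpleGraph V} {S : Set V} {H : SimpleGraph W}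
  {H' : SimpleGraph W'}

@[simp] theorem joinAlong_inl_inl {a b : V} :
    (joinAlong G S H).Adj (.inl a) (.inl b) ↔ G.Adj a b := Iff.rfl
@[simp] theorem joinAlong_inr_inr {a b : W} :
    (joinAlong G S H).Adj (.inr a) (.inr b) ↔ H.Adj a b := Iff.rfl
@[simp] theorem joinAlong_inl_inr {a : V} {b : W} :
    (joinAlong G S H).Adj (.inl a) (.inr b) ↔ a ∈ S := Iff.rfl
@[simp] theorem joinAlong_inr_inl {a : W} {b : V} :
    (joinAlong G S H).Adj (.inr a) (.inl b) ↔ b ∈ S := Iff.rfl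

/-- Collapsing all of `H` to a single vertex of `H'` contracts the edges of `H` and keeps all other
edges. -/
theorem edist_joinAlong_inl_le [Nonempty W'] (a b : V) :
    (joinAlong G S H').edist (.inl a) (.inl b) ≤ (joinAlong G S H).edist (.inl a) (.inl b) := by
  obtain ⟨w⟩ := ‹Nonempty W'›
  refine edist_map_le (Sum.elim Sum.inl fun _ => Sum.inr w) ?_ (.inl a) (.inl b)
  rintro (a | a) (b | b) h <;> first | exact Or.inr h | exact Or.inl rfl

theorem edist_joinAlong_inl_eq [Nonempty W] [Nonempty W'] (a b : V) :
    (joinAlong G S H).edist (.inl a) (.inl b) = (joinAlong G S H').edist (.inl a) (.inl b) :=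
  le_antisymm (edist_joinAlong_inl_le a b) (edist_joinAlong_inl_le a b)

/-- The conditions on a graph `G` and a vertex set `S` under which the eccentricity matrix of
`joinAlong G S H` has a block form. -/
structure IsJoinBase (G : SimpleGraph V) (S : Set V) : Prop where
  exists_adj : ∀ x ∉ S, ∃ y ∈ S, G.Adj x y
  exists_notMem : ∃ x, x ∉ S
  exists_far : ∀ x, ∃ y, x ≠ y ∧ ¬ G.Adj x y

theorem IsJoinBase.edist_inl_inr_le (hb : IsJoinBase G S) (x : V) (w : W) :
    (joinAlong G S H).edist (.inl x) (.inr w) ≤ 2 := by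
  by_cases hx : x ∈ S
  · rw [SimpleGraph.edist_eq_one_iff_adj.mpr (joinAlong_inl_inr.mpr hx)]
    exact one_le_two
  · obtain ⟨y, hy, hxy⟩ := hb.exists_adj x hx
    exact edist_le_two (joinAlong_inl_inl.mpr hxy) (joinAlong_inl_inr.mpr hy)

theorem IsJoinBase.edist_inl_inr (hb : IsJoinBase G S) {x : V} (hx : x ∉ S) (w : W) :
    (joinAlong G S H).edist (.inl x) (.inr w) = 2 :=
  le_antisymm (hb.edist_inl_inr_le x w) (two_le_edist (by simp) hx)

theorem IsJoinBase.edist_inr_inr_le (hb : IsJoinBase G S) (w w' : W) :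
    (joinAlong G S H).edist (.inr w) (.inr w') ≤ 2 := by
  obtain ⟨x, hx⟩ := hb.exists_notMem
  obtain ⟨y, hy, -⟩ := hb.exists_adj x hx
  exact edist_le_two (joinAlong_inr_inl.mpr hy) (joinAlong_inl_inr.mpr hy)

theorem IsJoinBase.eccent_inr (hb : IsJoinBase G S) (w : W) : (joinAlong G S H).eccent (.inr w) = 2 := by
  refine le_antisymm (iSup_le ?_) ?_
  · rintro (x | w')
    · rw [SimpleGraph.edist_comm]; exact hb.edist_inl_inr_le x w
    · exact hb.edist_inr_inr_le w w'
  · obtain ⟨x, hx⟩ := hb.exists_notMem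
    rw [← hb.edist_inl_inr (H := H) hx w, SimpleGraph.edist_comm]
    exact SimpleGraph.edist_le_eccent

theorem IsJoinBase.exists_two_le_edist (hb : IsJoinBase G S) (x : V) :
    ∃ y, 2 ≤ (joinAlong G S H).edist (.inl x) (.inl y) := by
  obtain ⟨y, hne, hadj⟩ := hb.exists_far x
  exact ⟨y, two_le_edist (by simpa using hne) hadj⟩

theorem IsJoinBase.two_le_eccent_inl (hb : IsJoinBase G S) (x : V) : 2 ≤ (joinAlong G S H).eccent (.inl x) := by
  obtain ⟨y, hy⟩ := hb.exists_two_le_edist (H := H) x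
  exact hy.trans SimpleGraph.edist_le_eccent

/-- Vertices of `H` lie within distance 2, and some base vertex is already that far, so `H` never
decides the supremum. -/
theorem IsJoinBase.eccent_inl (hb : IsJoinBase G S) (x : V) :
    (joinAlong G S H).eccent (.inl x) = ⨆ y, (joinAlong G S H).edist (.inl x) (.inl y) := by
  refine le_antisymm (iSup_le ?_) (iSup_le fun y => SimpleGraph.edist_le_eccent)
  rintro (y | w)
  · exact le_iSup (fun y => (joinAlong G S H).edist (.inl x) (.inl y)) y
  · obtain ⟨y, hy⟩ := hb.exists_two_le_edist (H := H) x
    exact ((hb.edist_inl_inr_le x w).trans hy).trans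
      (le_iSup (fun y => (joinAlong G S H).edist (.inl x) (.inl y)) y)

theorem IsJoinBase.eccMatrix_inl_inl_eq (hb : IsJoinBase G S) [Nonempty W] [Nonempty W'] (x y : V) :
    eccMatrix (joinAlong G S H) (.inl x) (.inl y) =
      eccMatrix (joinAlong G S H') (.inl x) (.inl y) := by
  simp only [eccMatrix, Matrix.of_apply, hb.eccent_inl, SimpleGraph.dist,
    edist_joinAlong_inl_eq (H := H) (H' := H')]

open Classical in
theorem IsJoinBase.eccMatrix_joinAlong (hb : IsJoinBase G S) :
    eccMatrix (joinAlong G S H) =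
      fromBlocks (eccMatrix (joinAlong G S H)).toBlocks₁₁
        (vecMulVec (fun x => if x ∈ S then 0 else 2) 1)
        (vecMulVec 1 fun x => if x ∈ S then 0 else 2)
        ((2 : ℝ) • (vecMulVec 1 1 - 1 - H.adjMatrix ℝ)) := by
  have key : ∀ x w, eccMatrix (joinAlong G S H) (.inl x) (.inr w) = if x ∈ S then 0 else 2 := by
    intro x w
    rw [eccMatrix, Matrix.of_apply, hb.eccent_inr, min_eq_right (hb.two_le_eccent_inl x)]
    by_cases hx : x ∈ S
    · rw [SimpleGraph.edist_eq_one_iff_adj.mpr (joinAlong_inl_inr.mpr hx), if_pos hx,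
        if_neg (by norm_num)]
    · have h := hb.edist_inl_inr (H := H) hx w
      rw [if_pos h, dist_eq_two_of_edist h, if_neg hx, Nat.cast_ofNat]
  ext (x | w) (y | w')
  · rfl
  · simp [key]
  · rw [fromBlocks_apply₂₁, vecMulVec_apply, ← key y w, Pi.one_apply, one_mul]
    simp only [eccMatrix, Matrix.of_apply, SimpleGraph.edist_comm (u := Sum.inr w),
      SimpleGraph.dist_comm (u := Sum.inr w), min_comm]
  · rw [fromBlocks_apply₂₂, eccMatrix, Matrix.of_apply, hb.eccent_inr, hb.eccent_inr, min_self]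
    by_cases hne : w = w'
    · subst hne
      simp
    by_cases hadj : H.Adj w w'
    · rw [SimpleGraph.edist_eq_one_iff_adj.mpr (joinAlong_inr_inr.mpr hadj),
        if_neg (by norm_num)]
      simp [hne, hadj]
    · have h : (joinAlong G S H).edist (.inr w) (.inr w') = 2 :=
        le_antisymm (hb.edist_inr_inr_le w w') (two_le_edist (by simpa using hne) hadj)
      rw [if_pos h, dist_eq_two_of_edist h]
      simp [hne, hadj]

end JoinAlong

/-! ### Subdivision graphs as bases -/

section Subdivision

variable {V : Type*} {G : SimpleGraph V}

/-- In a subdivision, vertices of the same kind are never adjacent, so any second vertex of that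
kind serves as the far one. -/
theorem isJoinBase_subdivision_range_inl [Nonempty G.edgeSet]
    (hV : ∀ v : V, ∃ w, v ≠ w) (hE : ∀ e : G.edgeSet, ∃ f, e ≠ f) :
    IsJoinBase (subdivision G) (Set.range Sum.inl) where
  exists_adj := by
    rintro (v | ⟨e, he⟩) hx
    · simp at hx
    · induction e using Sym2.ind with
      | _ a b => exact ⟨.inl a, ⟨a, rfl⟩, Sym2.mem_mk_left a b⟩
  exists_notMem := ⟨.inr (Classical.arbitrary _), by simp⟩
  exists_far := by
    rintro (v | e)
    · obtain ⟨w, hw⟩ := hV v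
      exact ⟨.inl w, by simpa using hw, id⟩
    · obtain ⟨f, hf⟩ := hE e
      exact ⟨.inr f, by simpa using hf, id⟩

theorem isJoinBase_subdivision_range_inr [Nonempty V]
    (hG : ∀ v, ∃ w, G.Adj v w) (hE : ∀ e : G.edgeSet, ∃ f, e ≠ f) :
    IsJoinBase (subdivision G) (Set.range Sum.inr) where
  exists_adj := by
    rintro (v | e) hx
    · obtain ⟨w, hw⟩ := hG v
      exact ⟨.inr ⟨s(v, w), hw⟩, ⟨_, rfl⟩, Sym2.mem_mk_left v w⟩
    · simp at hx
  exists_notMem := ⟨.inl (Classical.arbitrary _), by simp⟩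
  exists_far := by
    rintro (v | e)
    · obtain ⟨w, hw⟩ := hG v
      exact ⟨.inl w, by simpa using hw.ne, id⟩
    · obtain ⟨f, hf⟩ := hE e
      exact ⟨.inr f, by simpa using hf, id⟩

theorem exists_edge_ne_of_isRegularOfDegree [G.LocallyFinite] {r : ℕ} (hr : 2 ≤ r)
    (hG : G.IsRegularOfDegree r) (e : G.edgeSet) : ∃ f, e ≠ f := by
  obtain ⟨e, he⟩ := e
  induction e using Sym2.ind with
  | _ a b =>
    have hcard : 1 < (G.neighborFinset a).card := by
      rw [SimpleGraph.card_neighborFinset_eq_degree, hG a]; omega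
    obtain ⟨c, hc, hcb⟩ := Finset.exists_mem_ne hcard b
    refine ⟨⟨s(a, c), by simpa using hc⟩, fun h => hcb ?_⟩
    exact (Sym2.congr_right.mp (congrArg Subtype.val h)).symm

theorem exists_adj_of_isRegularOfDegree [G.LocallyFinite] {r : ℕ} (hr : 0 < r)
    (hG : G.IsRegularOfDegree r) (v : V) : ∃ w, G.Adj v w := by
  rw [← SimpleGraph.degree_pos_iff_exists_adj, hG v]; exact hr

end Subdivision

end EccentricityGraphs

namespace EccentricityGraphs

open Matrix Polynomial

/-! ### Spectra of real matrices -/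

section MatrixSpectrum

variable {n : Type*} [Fintype n] [DecidableEq n]

theorem matrixSpectrum_eq_roots (M : Matrix n n ℝ) : matrixSpectrum M = M.charpoly.roots := by
  unfold matrixSpectrum
  congr!

theorem card_matrixSpectrum {M : Matrix n n ℝ} (hM : M.IsHermitian) :
    (matrixSpectrum M).card = Fintype.card n := by
  rw [matrixSpectrum_eq_roots, hM.roots_charpoly_eq_eigenvalues, Multiset.card_map]
  rfl

theorem sum_matrixSpectrum {M : Matrix n n ℝ} (hM : M.IsHermitian) :
    (matrixSpectrum M).sum = M.trace := by
  rw [matrixSpectrum_eq_roots, trace_eq_sum_roots_charpoly_of_splits hM.splits_charpoly]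

theorem nonneg_of_mem_matrixSpectrum {M : Matrix n n ℝ} (hM : M.PosSemidef) {x : ℝ}
    (hx : x ∈ matrixSpectrum M) : 0 ≤ x := by
  rw [matrixSpectrum_eq_roots, hM.isHermitian.roots_charpoly_eq_eigenvalues,
    Multiset.mem_map] at hx
  obtain ⟨i, -, rfl⟩ := hx
  exact hM.eigenvalues_nonneg i

theorem eval_charpoly_eq_det (M : Matrix n n ℝ) (x : ℝ) :
    M.charpoly.eval x = (x • (1 : Matrix n n ℝ) - M).det := by
  rw [Matrix.eval_charpoly, Matrix.scalar_apply, Matrix.smul_one_eq_diagonal]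

theorem matrixSpectrum_smul_add_smul_one {M : Matrix n n ℝ} (hM : M.IsHermitian) (a b : ℝ)
    (ha : a ≠ 0) :
    matrixSpectrum (a • M + b • 1) = (matrixSpectrum M).map fun x => a * x + b := by
  have h : (a • M + b • 1).charpoly = ∏ i, (X - C (a * hM.eigenvalues i + b)) := by
    refine Polynomial.funext fun x => ?_
    have hx : x • (1 : Matrix n n ℝ) - (a • M + b • 1) = a • (((x - b) / a) • 1 - M) := by
      rw [smul_sub, smul_smul, mul_div_cancel₀ _ ha, sub_smul]; abel
    rw [eval_charpoly_eq_det, hx, det_smul, ← eval_charpoly_eq_det, hM.charpoly_eq, eval_prod,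
      eval_prod, ← Finset.card_univ, ← Finset.prod_const, ← Finset.prod_mul_distrib]
    refine Finset.prod_congr rfl fun i _ => ?_
    simp only [eval_sub, eval_X, eval_C, RCLike.ofReal_real_eq_id, id]
    field_simp
    ring
  rw [matrixSpectrum_eq_roots, matrixSpectrum_eq_roots, h, hM.roots_charpoly_eq_eigenvalues,
    Polynomial.roots_prod _ _ (Finset.prod_ne_zero_iff.mpr fun i _ => X_sub_C_ne_zero _)]
  simp only [roots_X_sub_C, Multiset.map_map]
  exact Multiset.bind_singleton _ _

theorem matrixSpectrum_fromBlocks_zero {m : Type*} [Fintype m] [DecidableEq m]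
    (A : Matrix m m ℝ) (D : Matrix n n ℝ) :
    matrixSpectrum (fromBlocks A 0 0 D) = matrixSpectrum A + matrixSpectrum D := by
  simp only [matrixSpectrum_eq_roots]
  rw [charpoly_fromBlocks_zero₁₂,
    Polynomial.roots_mul (mul_ne_zero A.charpoly_monic.ne_zero D.charpoly_monic.ne_zero)]

/-- Padding both sides with zeros avoids asking which of the two products is larger. -/
theorem matrixSpectrum_mul_comm {m : Type*} [Fintype m] [DecidableEq m]
    (A : Matrix m n ℝ) (B : Matrix n m ℝ) :
    Multiset.replicate (Fintype.card n) 0 + matrixSpectrum (A * B) =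
      Multiset.replicate (Fintype.card m) 0 + matrixSpectrum (B * A) := by
  have h := congrArg roots (charpoly_mul_comm' A B)
  have hX (k : ℕ) : (X ^ k : ℝ[X]) ≠ 0 := pow_ne_zero _ X_ne_zero
  rwa [Polynomial.roots_mul (mul_ne_zero (hX _) (charpoly_monic _).ne_zero),
    Polynomial.roots_mul (mul_ne_zero (hX _) (charpoly_monic _).ne_zero), roots_X_pow, roots_X_pow,
    Multiset.nsmul_singleton, Multiset.nsmul_singleton, ← matrixSpectrum_eq_roots,
    ← matrixSpectrum_eq_roots] at h

end MatrixSpectrum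

/-! ### Block matrices with rank-one off-diagonal blocks -/

section BlockSpectrum

variable {m n p : Type*} [Fintype m] [Fintype n] [Fintype p] [DecidableEq m] [DecidableEq n]
  [DecidableEq p]

theorem det_one_sub_smul_vecMulVec_one (a : ℝ) :
    (1 - a • vecMulVec 1 1 : Matrix n n ℝ).det = 1 - a * Fintype.card n := by
  have h := det_one_add_replicateCol_mul_replicateRow (ι := Unit) (-a • (1 : n → ℝ)) 1
  rw [← vecMulVec_eq, smul_vecMulVec, neg_smul, ← sub_eq_add_neg] at h
  rw [h]
  simp [dotProduct, sub_eq_add_neg, mul_comm]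

/-- Because 1 is an eigenvector of `B`, the inverse of the lower-right block acts on it as a scalar.
The Schur complement then sees `B` only through `β` and its size. -/
theorem det_sub_fromBlocks_vecMulVec (M : Matrix m m ℝ) (c : m → ℝ) {B : Matrix n n ℝ}
    {β k x : ℝ} (hB : B *ᵥ 1 = β • 1) (hx : x - β ≠ 0)
    (hxk : x - β - k * Fintype.card n ≠ 0) (hdet : (x • (1 : Matrix n n ℝ) - B).det ≠ 0) :
    (x • (1 : Matrix (m ⊕ n) (m ⊕ n) ℝ) -
        fromBlocks M (vecMulVec c 1) (vecMulVec 1 c) (k • vecMulVec 1 1 + B)).det =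
      (x • (1 : Matrix n n ℝ) - B).det * ((1 - k / (x - β) * Fintype.card n) *
        (x • (1 : Matrix m m ℝ) - M -
          (Fintype.card n / (x - β - k * Fintype.card n)) • vecMulVec c c).det) := by
  set P : Matrix n n ℝ := x • 1 - B with hP
  set P' : Matrix n n ℝ := P - k • vecMulVec 1 1 with hP'
  have hP1 : P *ᵥ 1 = (x - β) • 1 := by
    rw [hP, sub_mulVec, smul_mulVec, one_mulVec, hB, sub_smul]
  -- The rank-one term factors through `P` because `P` scales 1 by `x - β`.
  have hfac : P' = P * (1 - (k / (x - β)) • vecMulVec 1 1) := by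
    rw [mul_sub, mul_one, Matrix.mul_smul, mul_vecMulVec, hP1, smul_vecMulVec, smul_smul,
      div_mul_cancel₀ _ hx]
  have hdetP' : P'.det = P.det * (1 - k / (x - β) * Fintype.card n) := by
    rw [hfac, det_mul, det_one_sub_smul_vecMulVec_one]
  have hne : (1 - k / (x - β) * Fintype.card n : ℝ) ≠ 0 := by
    intro h
    apply hxk
    field_simp at h
    linarith
  have hunit : IsUnit P'.det := by
    rw [hdetP']
    exact (mul_ne_zero hdet hne).isUnit
  have hP'1 : P' *ᵥ 1 = (x - β - k * Fintype.card n) • 1 := by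
    rw [hP', sub_mulVec, hP1, smul_mulVec, vecMulVec_mulVec, sub_smul]
    ext i
    simp [dotProduct]
  let _ := P'.invertibleOfIsUnitDet hunit
  have hinv : ⅟P' * (vecMulVec 1 c : Matrix n m ℝ) = (x - β - k * Fintype.card n)⁻¹ • vecMulVec 1 c := by
    have h : P' * (vecMulVec 1 c : Matrix n m ℝ) = (x - β - k * Fintype.card n) • vecMulVec 1 c := by
      rw [mul_vecMulVec, hP'1, smul_vecMulVec]
    rw [← inv_smul_smul₀ hxk (⅟P' * (vecMulVec 1 c : Matrix n m ℝ)), ← Matrix.mul_smul, ← h, Matrix.invOf_mul_cancel_left]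
  have hblocks : x • (1 : Matrix (m ⊕ n) (m ⊕ n) ℝ) -
      fromBlocks M (vecMulVec c 1) (vecMulVec 1 c) (k • vecMulVec 1 1 + B) =
      fromBlocks (x • 1 - M) (-vecMulVec c 1) (-vecMulVec 1 c) P' := by
    rw [← fromBlocks_one, fromBlocks_smul, sub_eq_add_neg, fromBlocks_neg, fromBlocks_add, hP', hP]
    simp only [smul_zero, zero_add, neg_add, fromBlocks_inj]
    exact ⟨rfl, trivial, trivial, by abel⟩
  rw [hblocks, det_fromBlocks₂₂, hdetP', mul_assoc]
  congr 4
  rw [Matrix.neg_mul, Matrix.neg_mul, Matrix.mul_neg, neg_neg, Matrix.mul_assoc, hinv, Matrix.mul_smul,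
    vecMulVec_mul_vecMulVec, vecMulVec_smul, smul_smul]
  congr 1
  simp [dotProduct, div_eq_inv_mul]

/-- The cofactor in the determinant formula is common to `B` and `B'`. Cross-multiplying by the
other characteristic polynomial gives an identity without division. -/
theorem matrixSpectrum_fromBlocks_vecMulVec (M : Matrix m m ℝ) (c : m → ℝ) {B : Matrix n n ℝ}
    {B' : Matrix p p ℝ} {β : ℝ} (k : ℝ) (hB : B *ᵥ 1 = β • 1) (hB' : B' *ᵥ 1 = β • 1)
    (hcard : Fintype.card n = Fintype.card p) :
    matrixSpectrum (fromBlocks M (vecMulVec c 1) (vecMulVec 1 c) (k • vecMulVec 1 1 + B)) +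
        matrixSpectrum B' =
      matrixSpectrum (fromBlocks M (vecMulVec c 1) (vecMulVec 1 c) (k • vecMulVec 1 1 + B')) +
        matrixSpectrum B := by
  simp only [matrixSpectrum_eq_roots]
  rw [← roots_mul (mul_ne_zero (charpoly_monic _).ne_zero (charpoly_monic _).ne_zero),
    ← roots_mul (mul_ne_zero (charpoly_monic _).ne_zero (charpoly_monic _).ne_zero)]
  congr 1
  apply eq_of_infinite_eval_eq
  -- Outside these finitely many points the determinant formula holds for both matrices, which
  -- suffices for polynomials.
  have hfin : ({β, β + k * Fintype.card p} ∪ (B.charpoly.rootSet ℝ ∪ B'.charpoly.rootSet ℝ)).Finite :=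
    (Set.toFinite _).union ((rootSet_finite _ _).union (rootSet_finite _ _))
  refine hfin.infinite_compl.mono fun x hx => ?_
  simp only [Set.mem_compl_iff, Set.mem_union, Set.mem_insert_iff, Set.mem_singleton_iff, not_or,
    mem_rootSet', not_and, Polynomial.map_id, Algebra.algebraMap_self, coe_aeval_eq_eval] at hx
  obtain ⟨⟨h1, h2⟩, h3, h4⟩ := hx
  have h3 := h3 (charpoly_monic _).ne_zero
  have h4 := h4 (charpoly_monic _).ne_zero
  rw [eval_charpoly_eq_det] at h3 h4
  have h1 := sub_ne_zero.mpr h1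
  have h2 : x - β - k * Fintype.card p ≠ 0 := by rwa [sub_sub, sub_ne_zero]
  simp only [Set.mem_ofPred_eq, eval_mul, eval_charpoly_eq_det]
  rw [det_sub_fromBlocks_vecMulVec M c hB h1 (hcard ▸ h2) h3,
    det_sub_fromBlocks_vecMulVec M c hB' h1 h2 h4, hcard]
  ring

end BlockSpectrum

end EccentricityGraphs

namespace EccentricityGraphs

open Matrix

/-! ### Regularity and adjacency spectra -/

section Degree

variable {V W : Type*} {G : SimpleGraph V} {H : SimpleGraph W}

/-- Every vertex of `G` has exactly `r` neighbours. -/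
def HasDegree (G : SimpleGraph V) (r : ℕ) : Prop :=
  ∀ v, (G.neighborSet v).ncard = r

theorem HasDegree.of_isRegularOfDegree [G.LocallyFinite] {r : ℕ} (h : G.IsRegularOfDegree r) :
    HasDegree G r := fun v => by
  rw [← h v, Set.ncard_eq_toFinset_card']; rfl

theorem HasDegree.degree_eq {r : ℕ} (h : HasDegree G r) (v : V) [Fintype (G.neighborSet v)] :
    G.degree v = r := by
  rw [← h v, Set.ncard_eq_toFinset_card']; rfl

theorem hasDegree_iff_mulVec [Fintype V] [DecidableRel G.Adj] {r : ℕ} :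
    HasDegree G r ↔ G.adjMatrix ℝ *ᵥ 1 = (r : ℝ) • 1 := by
  have key (v : V) : (G.adjMatrix ℝ *ᵥ 1) v = ((G.neighborSet v).ncard : ℝ) := by
    rw [SimpleGraph.adjMatrix_mulVec_apply, Set.ncard_eq_toFinset_card']
    simp only [Pi.one_apply, Finset.sum_const, nsmul_one]
    rfl
  constructor
  · intro h
    ext v
    rw [key, h v]
    simp
  · intro h v
    have := congrFun h v
    rw [key] at this
    simpa using this

theorem HasDegree.sum {r : ℕ} (hG : HasDegree G r) (hH : HasDegree H r) :
    HasDegree (G ⊕g H) r := by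
  rintro (v | w)
  · rw [← hG v, ← Set.ncard_image_of_injective (G.neighborSet v)
      (Sum.inl_injective (β := W))]
    congr 1
    ext (x | x) <;> simp
  · rw [← hH w, ← Set.ncard_image_of_injective (H.neighborSet w)
      (Sum.inr_injective (α := V))]
    congr 1
    ext (x | x) <;> simp

end Degree

section AdjSpectrum

variable {V W : Type*}

theorem adjSpectrum_eq [Finite V] (G : SimpleGraph V) [DecidableRel G.Adj] :
    adjSpectrum G = matrixSpectrum (G.adjMatrix ℝ) := by
  unfold adjSpectrum
  congr!

theorem isHermitian_adjMatrix (G : SimpleGraph V) [DecidableRel G.Adj] :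
    (G.adjMatrix ℝ).IsHermitian := by
  rw [Matrix.IsHermitian, conjTranspose_eq_transpose_of_trivial, SimpleGraph.transpose_adjMatrix]

theorem card_adjSpectrum [Finite V] (G : SimpleGraph V) : (adjSpectrum G).card = Nat.card V := by
  classical
  cases nonempty_fintype V
  rw [adjSpectrum_eq, card_matrixSpectrum (isHermitian_adjMatrix G), Nat.card_eq_fintype_card]

theorem sum_adjSpectrum [Finite V] (G : SimpleGraph V) : (adjSpectrum G).sum = 0 := by
  classical
  cases nonempty_fintype V
  rw [adjSpectrum_eq, sum_matrixSpectrum (isHermitian_adjMatrix G), SimpleGraph.trace_adjMatrix]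

theorem adjSpectrum_sum [Finite V] [Finite W] (G : SimpleGraph V) (H : SimpleGraph W) :
    adjSpectrum (G ⊕g H) = adjSpectrum G + adjSpectrum H := by
  classical
  cases nonempty_fintype V
  cases nonempty_fintype W
  rw [adjSpectrum_eq, adjSpectrum_eq, adjSpectrum_eq, ← matrixSpectrum_fromBlocks_zero]
  congr 1
  ext (x | x) (y | y) <;> simp [SimpleGraph.adjMatrix_apply]

end AdjSpectrum

/-! ### Line graphs of regular graphs through the incidence matrix -/

section LineGraph

variable {V : Type*} {G : SimpleGraph V}

/-- The vertex-edge incidence matrix, with columns indexed by the edges. -/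
def edgeIncMatrix (G : SimpleGraph V) [DecidableEq V] : Matrix V G.edgeSet ℝ :=
  Matrix.of fun v e => if v ∈ (e : Sym2 V) then 1 else 0

theorem edgeIncMatrix_apply [DecidableEq V] [DecidableRel G.Adj] (v : V) (e : G.edgeSet) :
    edgeIncMatrix G v e = G.incMatrix ℝ v e := by
  rw [edgeIncMatrix, of_apply, SimpleGraph.incMatrix_apply']
  congr 1
  simp [SimpleGraph.incidenceSet, e.2]

theorem sum_edgeSet_eq_sum_sym2 [Fintype V] [Fintype G.edgeSet] (f : Sym2 V → ℝ)
    (hf : ∀ e ∉ G.edgeSet, f e = 0) :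
    ∑ e : G.edgeSet, f e = ∑ e, f e := by
  rw [← Finset.sum_subset (Finset.subset_univ G.edgeFinset) fun e _ he => hf e (by simpa using he)]
  exact (Finset.sum_subtype _ (fun _ => SimpleGraph.mem_edgeFinset) f).symm

section Incidence

variable [Fintype V] [DecidableEq V]

/-- An edge has two ends, and distinct edges share at most one vertex. -/
theorem edgeIncMatrix_transpose_mul_self [Fintype G.edgeSet] [DecidableRel G.lineGraph.Adj] :
    (edgeIncMatrix G)ᵀ * edgeIncMatrix G = G.lineGraph.adjMatrix ℝ + (2 : ℝ) • 1 := by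
  ext ⟨e, he⟩ ⟨f, hf⟩
  simp only [edgeIncMatrix, mul_apply, transpose_apply, of_apply, Matrix.add_apply,
    SimpleGraph.adjMatrix_apply, Matrix.smul_apply, Matrix.one_apply, mul_ite, mul_one, mul_zero,
    smul_eq_mul, Subtype.mk.injEq]
  by_cases hef : e = f
  · subst hef
    rw [if_neg (SimpleGraph.irrefl _), if_pos rfl, zero_add]
    induction e using Sym2.ind with
    | _ a b =>
      have hab : a ≠ b := SimpleGraph.Adj.ne he
      have h (x : V) : (if x ∈ s(a, b) then (if x ∈ s(a, b) then (1 : ℝ) else 0) else 0) =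
          (if x = a then 1 else 0) + if x = b then 1 else 0 := by
        by_cases h1 : x = a <;> by_cases h2 : x = b <;> simp_all
      simp only [h, Finset.sum_add_distrib, Finset.sum_ite_eq', Finset.mem_univ, if_true]
      norm_num
  · rw [if_neg hef, add_zero]
    have hadj : G.lineGraph.Adj ⟨e, he⟩ ⟨f, hf⟩ ↔ ∃ v, v ∈ e ∧ v ∈ f := by
      simp [SimpleGraph.lineGraph, hef, Set.Nonempty]
    by_cases hv : ∃ v, v ∈ e ∧ v ∈ f
    · rw [if_pos (hadj.mpr hv)]
      obtain ⟨v, hve, hvf⟩ := hv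
      rw [Finset.sum_eq_single v]
      · simp [hve, hvf]
      · intro w _ hw
        by_contra h
        have hwe : w ∈ e := by by_contra h'; simp [h'] at h
        have hwf : w ∈ f := by by_contra h'; simp [h'] at h
        exact hef (((Sym2.mem_and_mem_iff hw).mp ⟨hwe, hve⟩).trans
          ((Sym2.mem_and_mem_iff hw).mp ⟨hwf, hvf⟩).symm)
      · simp
    · rw [if_neg (hadj.not.mpr hv)]
      refine Finset.sum_eq_zero fun w _ => ?_
      split_ifs with h1 h2
      · exact absurd ⟨w, h2, h1⟩ hv
      · rfl
      · rfl

variable [DecidableRel G.Adj]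

theorem edgeIncMatrix_mul_transpose [Fintype G.edgeSet] {r : ℕ} (hG : HasDegree G r) :
    edgeIncMatrix G * (edgeIncMatrix G)ᵀ = G.adjMatrix ℝ + (r : ℝ) • 1 := by
  ext u v
  have h : (edgeIncMatrix G * (edgeIncMatrix G)ᵀ) u v =
      (G.incMatrix ℝ * (G.incMatrix ℝ)ᵀ) u v := by
    simp only [mul_apply, transpose_apply, edgeIncMatrix_apply]
    refine sum_edgeSet_eq_sum_sym2 (fun e => G.incMatrix ℝ u e * G.incMatrix ℝ v e) fun e he => ?_
    rw [SimpleGraph.incMatrix_of_notMem_incidenceSet G fun h => he h.1, zero_mul]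
  rw [h, SimpleGraph.incMatrix_mul_transpose, of_apply, hG.degree_eq]
  by_cases huv : u = v
  · subst huv; simp
  · simp [huv]

theorem edgeIncMatrix_mulVec_one [Fintype G.edgeSet] {r : ℕ} (hG : HasDegree G r) :
    edgeIncMatrix G *ᵥ 1 = (r : ℝ) • 1 := by
  ext v
  simp only [mulVec, dotProduct, edgeIncMatrix_apply, Pi.one_apply, mul_one, Pi.smul_apply,
    smul_eq_mul]
  rw [sum_edgeSet_eq_sum_sym2 (fun e => G.incMatrix ℝ v e) fun e he =>
    SimpleGraph.incMatrix_of_notMem_incidenceSet G fun h => he h.1]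
  rw [SimpleGraph.sum_incMatrix_apply, hG.degree_eq]

theorem edgeIncMatrix_transpose_mulVec_one [Fintype G.edgeSet] :
    (edgeIncMatrix G)ᵀ *ᵥ 1 = (2 : ℝ) • 1 := by
  ext e
  simp only [mulVec, dotProduct, transpose_apply, edgeIncMatrix_apply, Pi.one_apply, mul_one,
    Pi.smul_apply, smul_eq_mul]
  exact SimpleGraph.sum_incMatrix_apply_of_mem_edgeSet G e.2

end Incidence

theorem HasDegree.lineGraph [Finite V] {k : ℕ} (hG : HasDegree G (k + 1)) :
    HasDegree G.lineGraph (2 * k) := by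
  classical
  cases nonempty_fintype V
  rw [hasDegree_iff_mulVec, eq_sub_of_add_eq edgeIncMatrix_transpose_mul_self.symm,
    sub_mulVec, ← mulVec_mulVec, edgeIncMatrix_mulVec_one hG, mulVec_smul,
    edgeIncMatrix_transpose_mulVec_one, smul_mulVec, one_mulVec, smul_smul, ← sub_smul]
  congr 1
  push_cast
  ring

/-- The entries of the incidence matrix are summed by rows and by columns. -/
theorem HasDegree.two_mul_card_edgeSet [Finite V] {r : ℕ} (hG : HasDegree G r) :
    2 * Nat.card G.edgeSet = Nat.card V * r := by
  classical
  cases nonempty_fintype V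
  have h := dotProduct_mulVec (1 : V → ℝ) (edgeIncMatrix G) 1
  rw [edgeIncMatrix_mulVec_one hG, ← mulVec_transpose, edgeIncMatrix_transpose_mulVec_one] at h
  simp only [dotProduct_smul, smul_dotProduct, one_dotProduct_one, smul_eq_mul] at h
  rw [Nat.card_eq_fintype_card, Nat.card_eq_fintype_card, mul_comm (Fintype.card V)]
  exact_mod_cast h.symm

/-- With N the incidence matrix, NNᵀ = A(G) + rI and NᵀN = A(L(G)) + 2I agree up to zero
eigenvalues; shifting by -2 turns the zeros into -2. -/
theorem adjSpectrum_lineGraph [Finite V] {r : ℕ} (hG : HasDegree G r) :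
    Multiset.replicate (Nat.card V) (-2) + adjSpectrum G.lineGraph =
      Multiset.replicate (Nat.card G.edgeSet) (-2) +
        (adjSpectrum G).map fun x => x + ((r : ℝ) - 2) := by
  classical
  cases nonempty_fintype V
  have h := congrArg (Multiset.map fun x => x - 2)
    (matrixSpectrum_mul_comm (edgeIncMatrix G) (edgeIncMatrix G)ᵀ)
  have hL := matrixSpectrum_smul_add_smul_one (isHermitian_adjMatrix G.lineGraph) 1 2 one_ne_zero
  have hA := matrixSpectrum_smul_add_smul_one (isHermitian_adjMatrix G) 1 r one_ne_zero
  rw [edgeIncMatrix_transpose_mul_self, edgeIncMatrix_mul_transpose hG] at h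
  rw [one_smul] at hL hA
  rw [hL, hA, ← adjSpectrum_eq, ← adjSpectrum_eq] at h
  simp only [Multiset.map_add, Multiset.map_replicate, Multiset.map_map, Function.comp_def,
    one_mul, add_sub_cancel_right, Multiset.map_id', zero_sub] at h
  rw [Nat.card_eq_fintype_card, Nat.card_eq_fintype_card, ← h]
  simp only [add_sub_assoc]

/-- A(G) + rI = NNᵀ is positive semidefinite. -/
theorem neg_le_of_mem_adjSpectrum [Finite V] {r : ℕ} (hG : HasDegree G r) {x : ℝ}
    (hx : x ∈ adjSpectrum G) : -r ≤ x := by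
  classical
  cases nonempty_fintype V
  have hA := matrixSpectrum_smul_add_smul_one (isHermitian_adjMatrix G) 1 r one_ne_zero
  rw [one_smul, ← edgeIncMatrix_mul_transpose hG, ← adjSpectrum_eq] at hA
  have hmem : 1 * x + r ∈ matrixSpectrum (edgeIncMatrix G * (edgeIncMatrix G)ᵀ) := by
    rw [hA]
    exact Multiset.mem_map_of_mem _ hx
  have hpos := posSemidef_self_mul_conjTranspose (edgeIncMatrix G)
  rw [conjTranspose_eq_transpose_of_trivial] at hpos
  linarith [nonneg_of_mem_matrixSpectrum hpos hmem]

end LineGraph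

end EccentricityGraphs

namespace EccentricityGraphs

open Matrix

/-! ### Comparing the ε-spectra of two joins -/

section EquienergeticJoin

variable {V W W' : Type*} [Finite V] [Finite W] [Finite W'] {G : SimpleGraph V} {S : Set V}
  {H : SimpleGraph W} {H' : SimpleGraph W'}

theorem HasDegree.smul_adjMatrix_add_smul_one_mulVec {U : Type*} [Fintype U] [DecidableEq U]
    {K : SimpleGraph U} [DecidableRel K.Adj] {d : ℕ} (hK : HasDegree K d) (a b : ℝ) :
    (a • K.adjMatrix ℝ + b • 1) *ᵥ 1 = (a * d + b) • 1 := by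
  rw [add_mulVec, smul_mulVec, smul_mulVec, hasDegree_iff_mulVec.mp hK, one_mulVec, smul_smul,
    ← add_smul]

theorem two_smul_vecMulVec_one_sub_one_sub {U : Type*} [DecidableEq U] (K : Matrix U U ℝ) :
    (2 : ℝ) • (vecMulVec 1 1 - 1 - K) =
      (2 : ℝ) • vecMulVec 1 1 + ((-2 : ℝ) • K + (-2 : ℝ) • 1) := by
  module

theorem IsJoinBase.eccSpectrum_joinAlong_add [Nonempty W] [Nonempty W'] (hb : IsJoinBase G S)
    {d : ℕ} (hH : HasDegree H d) (hH' : HasDegree H' d) (hcard : Nat.card W = Nat.card W') :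
    eccSpectrum (joinAlong G S H) + (adjSpectrum H').map (fun x => -2 * x + -2) =
      eccSpectrum (joinAlong G S H') + (adjSpectrum H).map fun x => -2 * x + -2 := by
  classical
  cases nonempty_fintype V
  cases nonempty_fintype W
  cases nonempty_fintype W'
  have hblock : (eccMatrix (joinAlong G S H)).toBlocks₁₁ =
      (eccMatrix (joinAlong G S H')).toBlocks₁₁ := by
    ext x y
    exact hb.eccMatrix_inl_inl_eq x y
  rw [eccSpectrum, eccSpectrum, hb.eccMatrix_joinAlong (H := H),
    hb.eccMatrix_joinAlong (H := H'), hblock, adjSpectrum_eq H, adjSpectrum_eq H',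
    ← matrixSpectrum_smul_add_smul_one (isHermitian_adjMatrix H) _ _ (by norm_num),
    ← matrixSpectrum_smul_add_smul_one (isHermitian_adjMatrix H') _ _ (by norm_num),
    two_smul_vecMulVec_one_sub_one_sub, two_smul_vecMulVec_one_sub_one_sub]
  exact matrixSpectrum_fromBlocks_vecMulVec _ _ 2
    (hH.smul_adjMatrix_add_smul_one_mulVec _ _) (hH'.smul_adjMatrix_add_smul_one_mulVec _ _)
    (by simpa [Nat.card_eq_fintype_card] using hcard)

theorem IsJoinBase.nonEccCospectral_and_eccEquienergetic [Nonempty W] [Nonempty W']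
    (hb : IsJoinBase G S) {d : ℕ} (hH : HasDegree H d) (hH' : HasDegree H' d)
    (hcard : Nat.card W = Nat.card W') (hne : adjSpectrum H ≠ adjSpectrum H')
    (hsum : ((adjSpectrum H).map fun x => |x + 1|).sum =
      ((adjSpectrum H').map fun x => |x + 1|).sum) :
    NonEccCospectral (joinAlong G S H) (joinAlong G S H') ∧
      EccEquienergetic (joinAlong G S H) (joinAlong G S H') := by
  have hcard' : Nat.card (V ⊕ W) = Nat.card (V ⊕ W') := by
    rw [Nat.card_sum, Nat.card_sum, hcard]
  have h := hb.eccSpectrum_joinAlong_add hH hH' hcard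
  refine ⟨⟨hcard', fun heq => hne ?_⟩, hcard', ?_⟩
  · rw [heq] at h
    -- The common part cancels, and an injective affine map recovers the adjacency spectra.
    have hinj : Function.Injective fun x : ℝ => -2 * x + -2 := fun x y hxy => by
      simpa using hxy
    exact (Multiset.map_injective hinj (add_left_cancel h)).symm
  · have h := congrArg (fun s : Multiset ℝ => (s.map fun x => |x|).sum) h
    have habs (x : ℝ) : |-2 * x + -2| = 2 * |x + 1| := by
      rw [show -2 * x + -2 = -2 * (x + 1) by ring, abs_mul]; norm_num
    simp only [Multiset.map_add, Multiset.sum_add, Multiset.map_map, Function.comp_def, habs,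
      Multiset.sum_map_mul_left, hsum] at h
    exact add_right_cancel h

end EquienergeticJoin

/-! ### Second line graphs of cubic graphs -/

section CubicGraph

variable {V V' : Type*} [Finite V] [Finite V'] {G : SimpleGraph V} {G' : SimpleGraph V'}

theorem HasDegree.adjSpectrum_lineGraph_injective {r : ℕ} (hG : HasDegree G r)
    (hG' : HasDegree G' r) (hcard : Nat.card V = Nat.card V')
    (h : adjSpectrum G.lineGraph = adjSpectrum G'.lineGraph) : adjSpectrum G = adjSpectrum G' := by
  have hE : Nat.card G.edgeSet = Nat.card G'.edgeSet := by
    have h1 := hG.two_mul_card_edgeSet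
    have h2 := hG'.two_mul_card_edgeSet
    rw [hcard] at h1
    omega
  have h1 := adjSpectrum_lineGraph hG
  rw [h, hcard, hE, adjSpectrum_lineGraph hG'] at h1
  exact (Multiset.map_injective (add_left_injective _) (add_left_cancel h1)).symm

theorem HasDegree.lineGraph₂ (hG : HasDegree G 3) : HasDegree (lineGraph₂ G) 6 :=
  HasDegree.lineGraph (k := 3) (HasDegree.lineGraph (k := 2) hG)

theorem HasDegree.card_lineGraph₂ (hG : HasDegree G 3) :
    Nat.card G.lineGraph.edgeSet = 3 * Nat.card V := by
  have h1 := hG.two_mul_card_edgeSet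
  have h2 := (HasDegree.lineGraph (k := 2) hG).two_mul_card_edgeSet
  omega

theorem HasDegree.adjSpectrum_lineGraph₂_injective (hG : HasDegree G 3) (hG' : HasDegree G' 3)
    (hcard : Nat.card V = Nat.card V')
    (h : adjSpectrum (EccentricityGraphs.lineGraph₂ G) =
      adjSpectrum (EccentricityGraphs.lineGraph₂ G')) : adjSpectrum G = adjSpectrum G' := by
  refine hG.adjSpectrum_lineGraph_injective hG' hcard ?_
  refine HasDegree.adjSpectrum_lineGraph_injective (HasDegree.lineGraph (k := 2) hG)
    (HasDegree.lineGraph (k := 2) hG') ?_ h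
  have h1 := hG.two_mul_card_edgeSet
  have h2 := hG'.two_mul_card_edgeSet
  omega

theorem HasDegree.sum_abs_adjSpectrum_lineGraph₂ (hG : HasDegree G 3) :
    ((adjSpectrum (EccentricityGraphs.lineGraph₂ G)).map fun x => |x + 1|).sum =
      6 * (Nat.card V : ℝ) := by
  have hL : HasDegree G.lineGraph 4 := HasDegree.lineGraph (k := 2) hG
  have hE : 2 * (Nat.card G.edgeSet : ℝ) = Nat.card V * 3 := by
    exact_mod_cast hG.two_mul_card_edgeSet
  have hE₂ : (Nat.card G.lineGraph.edgeSet : ℝ) = 3 * Nat.card V := by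
    exact_mod_cast hG.card_lineGraph₂
  have h0 : ((adjSpectrum G).map fun x => |x + 4|).sum = 4 * (Nat.card V : ℝ) := by
    have h : (adjSpectrum G).map (fun x => |x + 4|) = (adjSpectrum G).map fun x => x + 4 := by
      refine Multiset.map_congr rfl fun x hx => abs_of_nonneg ?_
      have := neg_le_of_mem_adjSpectrum hG hx
      push_cast at this
      linarith
    rw [h, Multiset.sum_map_add, Multiset.map_id', sum_adjSpectrum, Multiset.map_const',
      Multiset.sum_replicate, card_adjSpectrum, nsmul_eq_mul]
    ring
  -- The shifts accumulate: L(G) is 4-regular, so |x + 1| on L² becomes |x + 3| on L(G), then |x +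
  -- 4| on G. Every padding -2 contributes 1 at both levels.
  have h1 := congrArg (fun s : Multiset ℝ => (s.map fun x => |x + 3|).sum)
    (adjSpectrum_lineGraph hG)
  have h2 := congrArg (fun s : Multiset ℝ => (s.map fun x => |x + 1|).sum)
    (adjSpectrum_lineGraph hL)
  simp only [Multiset.map_add, Multiset.sum_add, Multiset.map_map, Function.comp_def,
    Multiset.map_replicate, Multiset.sum_replicate, nsmul_eq_mul, add_assoc] at h1 h2
  norm_num [-Nat.card_coe_set_eq] at h1 h2
  rw [h0] at h1
  linarith

end CubicGraph

end EccentricityGraphs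

open scoped SimpleGraph
open EccentricityGraphs
theorem mainTheorem10 {V₁ V₂ V : Type*} [Finite V₁] [Finite V₂] [Finite V] [Nonempty V]
    (G₁ : SimpleGraph V₁) (G₂ : SimpleGraph V₂) (G : SimpleGraph V)
    [G₁.LocallyFinite] [G₂.LocallyFinite] [G.LocallyFinite]
    (t : ℕ) (ht : 2 ≤ t) (hV₁ : Nat.card V₁ = 2 * t) (hV₂ : Nat.card V₂ = 2 * t)
    (hG₁ : G₁.IsRegularOfDegree 3) (hG₂ : G₂.IsRegularOfDegree 3)
    (hG₁₂ : NonCospectral G₁ G₂)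
    (r : ℕ) (hr : 2 ≤ r) (hG : G.IsRegularOfDegree r) :
    (NonEccCospectral (subdivVertexJoin G (lineGraph₂ G₁))
        (subdivVertexJoin G (lineGraph₂ G₂)) ∧
      EccEquienergetic (subdivVertexJoin G (lineGraph₂ G₁))
        (subdivVertexJoin G (lineGraph₂ G₂))) ∧
    (NonEccCospectral (subdivEdgeJoin G (lineGraph₂ G₁))
        (subdivEdgeJoin G (lineGraph₂ G₂)) ∧
      EccEquienergetic (subdivEdgeJoin G (lineGraph₂ G₁))
        (subdivEdgeJoin G (lineGraph₂ G₂))) ∧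
    (NonEccCospectral (subdivVertexJoin G (lineGraph₂ G₁ ⊕g lineGraph₂ G₂))
        (subdivVertexJoin G (lineGraph₂ G₁ ⊕g lineGraph₂ G₁)) ∧
      EccEquienergetic (subdivVertexJoin G (lineGraph₂ G₁ ⊕g lineGraph₂ G₂))
        (subdivVertexJoin G (lineGraph₂ G₁ ⊕g lineGraph₂ G₁))) ∧
    (NonEccCospectral (subdivVertexJoin G (lineGraph₂ G₁ ⊕g lineGraph₂ G₂))
        (subdivVertexJoin G (lineGraph₂ G₂ ⊕g lineGraph₂ G₂)) ∧
      EccEquienergetic (subdivVertexJoin G (lineGraph₂ G₁ ⊕g lineGraph₂ G₂))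
        (subdivVertexJoin G (lineGraph₂ G₂ ⊕g lineGraph₂ G₂))) ∧
    (NonEccCospectral (subdivVertexJoin G (lineGraph₂ G₁ ⊕g lineGraph₂ G₁))
        (subdivVertexJoin G (lineGraph₂ G₂ ⊕g lineGraph₂ G₂)) ∧
      EccEquienergetic (subdivVertexJoin G (lineGraph₂ G₁ ⊕g lineGraph₂ G₁))
        (subdivVertexJoin G (lineGraph₂ G₂ ⊕g lineGraph₂ G₂))) ∧
    (NonEccCospectral (subdivEdgeJoin G (lineGraph₂ G₁ ⊕g lineGraph₂ G₂))
        (subdivEdgeJoin G (lineGraph₂ G₁ ⊕g lineGraph₂ G₁)) ∧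
      EccEquienergetic (subdivEdgeJoin G (lineGraph₂ G₁ ⊕g lineGraph₂ G₂))
        (subdivEdgeJoin G (lineGraph₂ G₁ ⊕g lineGraph₂ G₁))) ∧
    (NonEccCospectral (subdivEdgeJoin G (lineGraph₂ G₁ ⊕g lineGraph₂ G₂))
        (subdivEdgeJoin G (lineGraph₂ G₂ ⊕g lineGraph₂ G₂)) ∧
      EccEquienergetic (subdivEdgeJoin G (lineGraph₂ G₁ ⊕g lineGraph₂ G₂))
        (subdivEdgeJoin G (lineGraph₂ G₂ ⊕g lineGraph₂ G₂))) ∧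
    (NonEccCospectral (subdivEdgeJoin G (lineGraph₂ G₁ ⊕g lineGraph₂ G₁))
        (subdivEdgeJoin G (lineGraph₂ G₂ ⊕g lineGraph₂ G₂)) ∧
      EccEquienergetic (subdivEdgeJoin G (lineGraph₂ G₁ ⊕g lineGraph₂ G₁))
        (subdivEdgeJoin G (lineGraph₂ G₂ ⊕g lineGraph₂ G₂))) := by
  have h₁ := HasDegree.of_isRegularOfDegree hG₁
  have h₂ := HasDegree.of_isRegularOfDegree hG₂
  have hcard : Nat.card V₁ = Nat.card V₂ := hV₁.trans hV₂.symm
  have hadj := exists_adj_of_isRegularOfDegree (by omega) hG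
  have hE := exists_edge_ne_of_isRegularOfDegree hr hG
  have : Nonempty G.edgeSet := by
    obtain ⟨w, hw⟩ := hadj (Classical.arbitrary V)
    exact ⟨⟨s(_, w), hw⟩⟩
  have hbv := isJoinBase_subdivision_range_inl
    (fun v => (hadj v).imp fun _ hw => SimpleGraph.Adj.ne hw) hE
  have hbe := isJoinBase_subdivision_range_inr hadj hE
  have hc₁ := h₁.card_lineGraph₂
  have hc₂ := h₂.card_lineGraph₂
  have : Nonempty G₁.lineGraph.edgeSet := (Nat.card_pos_iff.mp (by omega)).1
  have : Nonempty G₂.lineGraph.edgeSet := (Nat.card_pos_iff.mp (by omega)).1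
  have hs₁ := h₁.sum_abs_adjSpectrum_lineGraph₂
  have hs₂ := h₂.sum_abs_adjSpectrum_lineGraph₂
  have hne : adjSpectrum (lineGraph₂ G₁) ≠ adjSpectrum (lineGraph₂ G₂) := fun h =>
    hG₁₂.2 (h₁.adjSpectrum_lineGraph₂_injective h₂ hcard h)
  have d₁ := h₁.lineGraph₂
  have d₂ := h₂.lineGraph₂
  have hne₁ : adjSpectrum (lineGraph₂ G₁ ⊕g lineGraph₂ G₂) ≠
      adjSpectrum (lineGraph₂ G₁ ⊕g lineGraph₂ G₁) := by
    rw [adjSpectrum_sum, adjSpectrum_sum]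
    exact fun h => hne (add_left_cancel h).symm
  have hne₂ : adjSpectrum (lineGraph₂ G₁ ⊕g lineGraph₂ G₂) ≠
      adjSpectrum (lineGraph₂ G₂ ⊕g lineGraph₂ G₂) := by
    rw [adjSpectrum_sum, adjSpectrum_sum]
    exact fun h => hne (add_right_cancel h)
  have hne₃ : adjSpectrum (lineGraph₂ G₁ ⊕g lineGraph₂ G₁) ≠
      adjSpectrum (lineGraph₂ G₂ ⊕g lineGraph₂ G₂) := by
    rw [adjSpectrum_sum, adjSpectrum_sum, ← two_nsmul, ← two_nsmul]
    -- Doubling a multiset is injective: compare multiplicities.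
    refine fun h => hne (Multiset.ext.mpr fun x => ?_)
    have hx := congrArg (Multiset.count x) h
    rw [Multiset.count_nsmul, Multiset.count_nsmul] at hx
    omega
  -- Both kinds of join are instances of this, with `S` the original or the subdividing vertices.
  have main (S : Set (V ⊕ G.edgeSet)) (hb : IsJoinBase (subdivision G) S) :=
    And.intro
      (hb.nonEccCospectral_and_eccEquienergetic d₁ d₂ (by omega) hne (by rw [hs₁, hs₂, hcard]))
    (And.intro
      (hb.nonEccCospectral_and_eccEquienergetic (d₁.sum d₂) (d₁.sum d₁)
        (by rw [Nat.card_sum, Nat.card_sum]; omega) hne₁ (by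
          simp only [adjSpectrum_sum, Multiset.map_add, Multiset.sum_add, hs₁, hs₂, hcard]))
    (And.intro
      (hb.nonEccCospectral_and_eccEquienergetic (d₁.sum d₂) (d₂.sum d₂)
        (by rw [Nat.card_sum, Nat.card_sum]; omega) hne₂ (by
          simp only [adjSpectrum_sum, Multiset.map_add, Multiset.sum_add, hs₁, hs₂, hcard]))
      (hb.nonEccCospectral_and_eccEquienergetic (d₁.sum d₁) (d₂.sum d₂)
        (by rw [Nat.card_sum, Nat.card_sum]; omega) hne₃ (by
          simp only [adjSpectrum_sum, Multiset.map_add, Multiset.sum_add, hs₁, hs₂, hcard]))))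
  obtain ⟨v₁, v₂, v₃, v₄⟩ := main _ hbv
  obtain ⟨e₁, e₂, e₃, e₄⟩ := main _ hbe
  exact ⟨v₁, e₁, v₂, v₃, v₄, e₂, e₃, e₄⟩
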